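/- There exist a universal constant $C>0$, a randomized algorithm and a polynomial $p$ in two variables such that the following holds for all integers $n\ge 1$, $d\ge 0$ and all $\delta\in(0,1)$. Put $\sigma=C\sqrt{\log(20n/\delta)}$. Given $n$, $d$, $\delta$ and any input in $(\mathbb{R}^d\times\mathbb{R})^n$, the algorithm halts after at most $p(n,\log(1/\delta))$ time units, for every outcome of its random samples, and so computes a (measurable, randomized) map $h:(\mathbb{R}^d\times\mathbb{R})^n\to(\mathbb{R}^d\times\mathbb{R})^n$. For all fixed covariates $x_1,\dots,x_n\in\mathbb{R}^d$, all fixed signs $R_1,\dots,R_n\in\{-1,1\}$ and every $\beta_\star\in\mathbb{R}^d$ with $\max_i|\langle x_i,\beta_\star\rangle|\le 1/2$, if $$y_i=R_i\langle x_i,\beta_\star\rangle+\xi_i,\qquad \xi_1,\dots,\xi_n\ \text{i.i.d. uniform on } [-1/2,1/2],$$ $$\widetilde y_i=|\langle x_i,\beta_\star\rangle|+\sigma\varepsilon_i,\qquad \varepsilon_1,\dots,\varepsilon_n\ \text{i.i.d. } \mathcal N(0,1),$$ and the algorithm's random samples are independent of $(\xi_i)_i$, then $$\mathsf{d_{TV}}\Big(h\big((x_i,y_i)_{i=1}^n\big),\,(x_i,\widetilde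 y_i)_{i=1}^n\Big)\le\delta,$$ where $\mathsf{d_{TV}}$ is the total variation distance $\sup_A|\mu(A)-\nu(A)|$ between laws. Time is measured on a random-access machine with exact real arithmetic and rational constants, whose input and output data are stored in the same memory cells; each arithmetic operation, comparison, memory access, evaluation of $\exp$, $\log$ or $\sqrt{\cdot}$, and each draw of an independent $\mathrm{Unif}([0,1])$ or $\mathcal N(0,1)$ sample takes one time unit. -/

import Mathlib

open MeasureTheory ProbabilityTheory

noncomputable section

/-! ## The two regression models -/

/-- Data sets: `n` pairs (covariate in `ℝ^d`, scalar response). -/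
abbrev RegData (n d : ℕ) : Type := Fin n → EuclideanSpace ℝ (Fin d) × ℝ

/-- The uniform distribution on the interval `[a, b]` (for `a < b`). -/
def unifLaw (a b : ℝ) : Measure ℝ := ProbabilityTheory.cond volume (Set.Icc a b)

/-- Law of `(x_i, y_i)_i` with `y_i = R_i ⟨x_i, β⟩ + ξ_i` and `ξ_i` i.i.d. uniform on
`[-1/2, 1/2]`, for fixed covariates `x` and fixed signs `R`. -/
def mixtureLaw {n d : ℕ} (x : Fin n → EuclideanSpace ℝ (Fin d)) (R : Fin n → ℝ)
    (β : EuclideanSpace ℝ (Fin d)) : Measure (RegData n d) :=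
  (Measure.pi fun _ : Fin n => unifLaw (-1 / 2) (1 / 2)).map
    fun ξ i => (x i, R i * inner ℝ (x i) β + ξ i)

/-- Law of `(x_i, y_i)_i` with `y_i = |⟨x_i, β⟩| + σ ε_i` and `ε_i` i.i.d. standard Gaussian,
for fixed covariates `x`. -/
def phaseLaw {n d : ℕ} (x : Fin n → EuclideanSpace ℝ (Fin d))
    (β : EuclideanSpace ℝ (Fin d)) (σ : ℝ) : Measure (RegData n d) :=
  (Measure.pi fun _ : Fin n => gaussianReal 0 1).map
    fun ε i => (x i, |inner ℝ (x i) β| + σ * ε i)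

/-- Total variation distance `sup_A |μ A - ν A|` over measurable `A` (for finite measures). -/
def tvDist {Ω : Type*} [MeasurableSpace Ω] (μ ν : Measure Ω) : ℝ :=
  ⨆ A : {A : Set Ω // MeasurableSet A}, |μ.real A.1 - ν.real A.1|

/-! ## A randomized random-access machine with real arithmetic

Programs of a `while` language. A state has natural-number registers, and arrays of real cells;
array `a`, cell `k` is addressed by a constant `a` and a computed index `k`. Each arithmetic
operation, comparison, evaluation of `exp`, `log`, `√`, memory access, and each draw of a uniform or
standard Gaussian sample takes unit time. -/
namespace RealRAM

/-- A random tape: an infinite supply of uniform samples and one of Gaussian samples. -/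
abbrev Tape : Type := (ℕ → ℝ) × (ℕ → ℝ)

/-- All entries of the tape are independent: the first component consists of `Unif [0, 1]`
samples, the second one of `N(0, 1)` samples. -/
def tapeLaw : Measure Tape :=
  (Measure.infinitePi fun _ : ℕ => unifLaw 0 1).prod
    (Measure.infinitePi fun _ : ℕ => gaussianReal 0 1)

/-- Machine states; `uPos` and `gPos` count the random samples used so far. -/
structure State where
  nat : ℕ → ℕ
  real : ℕ → ℕ → ℝ
  uPos : ℕ
  gPos : ℕ

/-- Write the natural-number register `v`. -/
def State.setNat (s : State) (v k : ℕ) : State :=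
  { s with nat := Function.update s.nat v k }

/-- Write cell `k` of the real array `a`. -/
def State.setReal (s : State) (a k : ℕ) (r : ℝ) : State :=
  { s with real := Function.update s.real a (Function.update (s.real a) k r) }

/-- Expressions for natural numbers (used for addresses and counters). -/
inductive NatExpr where
  | const (k : ℕ)
  | reg (v : ℕ)
  | add (e f : NatExpr)
  | sub (e f : NatExpr)
  | mul (e f : NatExpr)

/-- Value of a natural-number expression (subtraction is truncated). -/
def NatExpr.eval (s : State) : NatExpr → ℕ
  | const k => k
  | reg v => s.nat v
  | add e f => e.eval s + f.eval s
  | sub e f => e.eval s - f.eval s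
  | mul e f => e.eval s * f.eval s

/-- Time to evaluate: the number of nodes. -/
def NatExpr.cost : NatExpr → ℕ
  | const _ => 1
  | reg _ => 1
  | add e f => e.cost + f.cost + 1
  | sub e f => e.cost + f.cost + 1
  | mul e f => e.cost + f.cost + 1

/-- Expressions for real numbers; constants are rational, so that no information can be hidden
in a program. -/
inductive RealExpr where
  | const (q : ℚ)
  | cell (a : ℕ) (k : NatExpr)
  | ofNat (e : NatExpr)
  | add (e f : RealExpr)
  | sub (e f : RealExpr)
  | mul (e f : RealExpr)
  | div (e f : RealExpr)
  | exp (e : RealExpr)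
  | log (e : RealExpr)
  | sqrt (e : RealExpr)

/-- Value of a real expression. -/
def RealExpr.eval (s : State) : RealExpr → ℝ
  | const q => (q : ℝ)
  | cell a k => s.real a (k.eval s)
  | ofNat e => (e.eval s : ℝ)
  | add e f => e.eval s + f.eval s
  | sub e f => e.eval s - f.eval s
  | mul e f => e.eval s * f.eval s
  | div e f => e.eval s / f.eval s
  | exp e => Real.exp (e.eval s)
  | log e => Real.log (e.eval s)
  | sqrt e => Real.sqrt (e.eval s)

/-- Time to evaluate: the number of nodes. -/
def RealExpr.cost : RealExpr → ℕ
  | const _ => 1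
  | cell _ k => k.cost + 1
  | ofNat e => e.cost + 1
  | add e f => e.cost + f.cost + 1
  | sub e f => e.cost + f.cost + 1
  | mul e f => e.cost + f.cost + 1
  | div e f => e.cost + f.cost + 1
  | exp e => e.cost + 1
  | log e => e.cost + 1
  | sqrt e => e.cost + 1

/-- Tests. -/
inductive BoolExpr where
  | natLe (e f : NatExpr)
  | realLe (e f : RealExpr)
  | not (b : BoolExpr)

/-- Truth of a test. -/
def BoolExpr.holds (s : State) : BoolExpr → Prop
  | natLe e f => e.eval s ≤ f.eval s
  | realLe e f => e.eval s ≤ f.eval s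
  | not b => ¬ b.holds s

/-- Time to evaluate: the number of nodes. -/
def BoolExpr.cost : BoolExpr → ℕ
  | natLe e f => e.cost + f.cost + 1
  | realLe e f => e.cost + f.cost + 1
  | not b => b.cost + 1

/-- Programs. `unif a k` and `gauss a k` store a fresh `Unif [0, 1]`, respectively `N(0, 1)`,
sample in cell `k` of array `a`. -/
inductive Prog where
  | skip
  | setNat (v : ℕ) (e : NatExpr)
  | setReal (a : ℕ) (k : NatExpr) (e : RealExpr)
  | unif (a : ℕ) (k : NatExpr)
  | gauss (a : ℕ) (k : NatExpr)
  | seq (P Q : Prog)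
  | ite (b : BoolExpr) (P Q : Prog)
  | while (b : BoolExpr) (P : Prog)

/-- `Exec ω P s s' t`: with random tape `ω`, the program `P` started in state `s` halts in state
`s'` after exactly `t` time units. -/
inductive Exec (ω : Tape) : Prog → State → State → ℕ → Prop
  | skip (s : State) : Exec ω .skip s s 1
  | setNat (s : State) (v : ℕ) (e : NatExpr) :
      Exec ω (.setNat v e) s (s.setNat v (e.eval s)) (e.cost + 1)
  | setReal (s : State) (a : ℕ) (k : NatExpr) (e : RealExpr) :
      Exec ω (.setReal a k e) s (s.setReal a (k.eval s) (e.eval s)) (k.cost + e.cost + 1)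
  | unif (s : State) (a : ℕ) (k : NatExpr) :
      Exec ω (.unif a k) s
        { s.setReal a (k.eval s) (ω.1 s.uPos) with uPos := s.uPos + 1 } (k.cost + 1)
  | gauss (s : State) (a : ℕ) (k : NatExpr) :
      Exec ω (.gauss a k) s
        { s.setReal a (k.eval s) (ω.2 s.gPos) with gPos := s.gPos + 1 } (k.cost + 1)
  | seq {P Q : Prog} {s s' s'' : State} {t t' : ℕ} :
      Exec ω P s s' t → Exec ω Q s' s'' t' → Exec ω (.seq P Q) s s'' (t + t')
  | iteTrue {b : BoolExpr} {P Q : Prog} {s s' : State} {t : ℕ} :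
      b.holds s → Exec ω P s s' t → Exec ω (.ite b P Q) s s' (b.cost + t)
  | iteFalse {b : BoolExpr} {P Q : Prog} {s s' : State} {t : ℕ} :
      ¬ b.holds s → Exec ω Q s s' t → Exec ω (.ite b P Q) s s' (b.cost + t)
  | whileTrue {b : BoolExpr} {P : Prog} {s s' s'' : State} {t t' : ℕ} :
      b.holds s → Exec ω P s s' t → Exec ω (.while b P) s' s'' t' →
        Exec ω (.while b P) s s'' (b.cost + t + t')
  | whileFalse {b : BoolExpr} {P : Prog} {s : State} :
      ¬ b.holds s → Exec ω (.while b P) s s b.cost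

/-- Executions are deterministic once the random tape is given. -/
theorem Exec.det {ω : Tape} {P : Prog} {s s₁ : State} {t₁ : ℕ} (h₁ : Exec ω P s s₁ t₁) :
    ∀ {s₂ : State} {t₂ : ℕ}, Exec ω P s s₂ t₂ → s₁ = s₂ ∧ t₁ = t₂ := by
  induction h₁ with
  | skip | setNat | setReal | unif | gauss => intro s₂ t₂ h; cases h; exact ⟨rfl, rfl⟩
  | seq _ _ ihP ihQ =>
    intro s₂ t₂ h
    cases h with
    | seq hP hQ =>
      obtain ⟨rfl, rfl⟩ := ihP hP
      obtain ⟨rfl, rfl⟩ := ihQ hQ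
      exact ⟨rfl, rfl⟩
  | iteTrue hb _ ih =>
    intro s₂ t₂ h
    cases h with
    | iteTrue _ hP => obtain ⟨rfl, rfl⟩ := ih hP; exact ⟨rfl, rfl⟩
    | iteFalse hb' _ => exact absurd hb hb'
  | iteFalse hb _ ih =>
    intro s₂ t₂ h
    cases h with
    | iteTrue hb' _ => exact absurd hb' hb
    | iteFalse _ hQ => obtain ⟨rfl, rfl⟩ := ih hQ; exact ⟨rfl, rfl⟩
  | whileTrue hb _ _ ihP ihW =>
    intro s₂ t₂ h
    cases h with
    | whileTrue _ hP hW =>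
      obtain ⟨rfl, rfl⟩ := ihP hP
      obtain ⟨rfl, rfl⟩ := ihW hW
      exact ⟨rfl, rfl⟩
    | whileFalse hb' => exact absurd hb hb'
  | whileFalse hb =>
    intro s₂ t₂ h
    cases h with
    | whileTrue hb' _ _ => exact absurd hb' hb
    | whileFalse _ => exact ⟨rfl, rfl⟩

/-- The state in which a program starts on the data set `D` with accuracy parameter `δ`:
registers `0` and `1` hold `n` and `d`; array `0` holds the entries of the covariates, array `1`
the responses, cell `0` of array `2` the number `δ`; everything else is zero. -/
def inputState {n d : ℕ} (δ : ℝ) (D : RegData n d) : State where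
  nat v := if v = 0 then n else if v = 1 then d else 0
  real a k :=
    if a = 0 then
      if h : k < n * d then
        (D (finProdFinEquiv.symm ⟨k, h⟩).1).1 (finProdFinEquiv.symm ⟨k, h⟩).2
      else 0
    else if a = 1 then
      if h : k < n then (D ⟨k, h⟩).2 else 0
    else if a = 2 ∧ k = 0 then δ
    else 0
  uPos := 0
  gPos := 0

/-- The data set read off from arrays `0` and `1` of a state. -/
def State.output (s : State) (n d : ℕ) : RegData n d := fun i =>
  (WithLp.toLp 2 fun j : Fin d => s.real 0 (finProdFinEquiv (i, j) : Fin (n * d)).1,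
    s.real 1 i.1)

/-- The program `P`, given `n`, `d`, `δ` and a data set, computes the randomized map `h` (a map of
the data set and the random tape) in at most `T` time units, on all data sets and all tapes. -/
def Prog.Computes (P : Prog) {n d : ℕ} (δ : ℝ) (h : RegData n d → Tape → RegData n d) (T : ℝ) :
    Prop :=
  ∀ (D : RegData n d) (ω : Tape), ∃ (s : State) (t : ℕ),
    Exec ω P (inputState δ D) s t ∧ s.output n d = h D ω ∧ (t : ℝ) ≤ T

/-- Law of the output of the randomized map `h` when the data set has law `μ` and the random tape
is independent of it. -/
def outputLaw {n d : ℕ} (h : RegData n d → Tape → RegData n d) (μ : Measure (RegData n d)) :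
    Measure (RegData n d) :=
  (μ.prod tapeLaw).map fun z => h z.1 z.2

end RealRAM

end

/-! Put `τ = ⟨x, β⟩` and let `φ_a` be the density of `N(a, σ²)`. The excess `a = |y| - 1/2` of a
response is either at most `0` or spread over `(0, |τ|]` with density `1`, whatever the sign `R`. So
if the output has density `φ_0` when `a ≤ 0` and `φ_0 + ∂_a φ_a` when `a > 0`, then averaging over
`ξ` gives `φ_0 + ∫_0^{|τ|} ∂_a φ_a da = φ_{|τ|}`, the target.

To sample from `φ_0 + ∂_a φ_a`, draw `z` from `φ_0` and reflect it about `a` with probability `-∂_a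
φ_a(z) / φ_0(z)`, clipped to `[0, 1]`. Since `∂_a φ_a` is odd about `a`, this carries its negative
part onto its positive part (`integral_reflect_gaussian`). The upper clip is inactive for `z ≥
-σ²/2` (`reflectProb_le_one`), so the output law is exact on `[-σ²/2, σ²/2]`
(`map_reflectSite_apply`).

Only the mass outside this window contributes an error. By `gaussianReal_real_Icc_compl_le` and
`abs_pi_real_sub_le` it totals at most `δ/10` over the `n` responses when `σ = 4 √(log (20 n / δ))`.
The map is one loop with bounded work per response. -/

/-! ### Uniform laws and randomized thresholds. -/

theorem unifLaw_eq_restrict {a b : ℝ} (h : b - a = 1) :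
    unifLaw a b = volume.restrict (Set.Icc a b) := by
  simp [unifLaw, ProbabilityTheory.cond, h]

instance isProbabilityMeasure_unifLaw_zero_one : IsProbabilityMeasure (unifLaw 0 1) := by
  rw [unifLaw_eq_restrict (by norm_num)]
  exact ⟨by simp⟩

instance isProbabilityMeasure_unifLaw_symm : IsProbabilityMeasure (unifLaw (-1 / 2) (1 / 2)) := by
  rw [unifLaw_eq_restrict (by norm_num)]
  exact ⟨by simp; norm_num⟩

/-- The value of `p` clipped to the unit interval. -/
noncomputable def unitClip (p : ℝ) : ℝ := max 0 (min 1 p)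

theorem measurable_unitClip : Measurable unitClip := by
  unfold unitClip; fun_prop

theorem unitClip_nonneg (p : ℝ) : 0 ≤ unitClip p := le_max_left _ _

theorem unitClip_le_one (p : ℝ) : unitClip p ≤ 1 :=
  max_le zero_le_one (min_le_left _ _)

/-- Comparing a uniform sample with `p` is a coin of bias `unitClip p`; the clipping needs no
separate instruction, even when `p` lies outside `[0, 1]`. -/
theorem integral_unif_threshold (p s t : ℝ) :
    ∫ u, (if p ≤ u then s else t) ∂(unifLaw 0 1) = s + unitClip p * (t - s) := by
  have hm : MeasurableSet {u : ℝ | p ≤ u}ᶜ := measurableSet_Ici.compl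
  have hf : (fun u : ℝ => if p ≤ u then s else t) =
      fun u => s + ({u : ℝ | p ≤ u}ᶜ).indicator (fun _ => t - s) u := by
    funext u
    by_cases h : p ≤ u <;> simp [Set.indicator, h]
  have hreal : (unifLaw 0 1).real {u : ℝ | p ≤ u}ᶜ = unitClip p := by
    have hset : ({u : ℝ | p ≤ u}ᶜ ∩ Set.Icc 0 1 : Set ℝ) =ᵐ[volume]
        (Set.Icc 0 (min 1 p) : Set ℝ) := by
      have h1 : {u : ℝ | p ≤ u}ᶜ = Set.Iio p := by ext; simp
      have h2 : Set.Icc (0 : ℝ) (min 1 p) = Set.Iic p ∩ Set.Icc 0 1 := by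
        ext x; simp only [Set.mem_Icc, le_min_iff, Set.mem_inter_iff, Set.mem_Iic]; tauto
      rw [h1, h2]
      exact ae_eq_set_inter (Iio_ae_eq_Iic (a := p)) (ae_eq_refl _)
    rw [unifLaw_eq_restrict (by norm_num), measureReal_def, Measure.restrict_apply hm,
      measure_congr hset, Real.volume_Icc, sub_zero, unitClip]
    rcases le_total 0 (min 1 p) with h | h
    · rw [ENNReal.toReal_ofReal h, max_eq_right h]
    · rw [ENNReal.ofReal_of_nonpos h, max_eq_left h]; rfl
  rw [hf, integral_add (integrable_const _) ((integrable_const _).indicator hm),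
    integral_indicator hm, setIntegral_const, hreal]
  simp

/-! ### Reflecting a centred Gaussian about a point. -/

/-- Derivative in the mean `a` of the density at `z` of the Gaussian law with variance `v`. -/
noncomputable def gaussianMeanDeriv (v : NNReal) (a z : ℝ) : ℝ := (z - a) / v * gaussianPDFReal a v z

theorem hasDerivAt_gaussianPDFReal_mean {v : NNReal} (hv : v ≠ 0) (a z : ℝ) :
    HasDerivAt (fun a => gaussianPDFReal a v z) (gaussianMeanDeriv v a z) a := by
  have hv' : (v : ℝ) ≠ 0 := by exact_mod_cast hv
  have h1 : HasDerivAt (fun a : ℝ => -(z - a) ^ 2 / (2 * v)) ((z - a) / v) a := by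
    have := ((((hasDerivAt_id a).const_sub z).pow 2).neg).div_const (2 * (v : ℝ))
    refine this.congr_deriv ?_
    simp; field_simp
  refine ((h1.exp).const_mul (√(2 * Real.pi * v))⁻¹).congr_deriv ?_
  rw [gaussianMeanDeriv, gaussianPDFReal]; ring

theorem continuous_gaussianMeanDeriv (v : NNReal) :
    Continuous fun q : ℝ × ℝ => gaussianMeanDeriv v q.1 q.2 := by
  unfold gaussianMeanDeriv gaussianPDFReal
  fun_prop

/-- This oddness about `a` is why a reflection can exchange the negative and positive parts of the
derivative. -/
theorem gaussianMeanDeriv_reflect (v : NNReal) (a z : ℝ) :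
    gaussianMeanDeriv v a (2 * a - z) = -gaussianMeanDeriv v a z := by
  have : 2 * a - z - a = -(z - a) := by ring
  rw [gaussianMeanDeriv, gaussianMeanDeriv, gaussianPDFReal, gaussianPDFReal, this]
  ring_nf

/-- Probability with which the point `z` is reflected about `a`. -/
noncomputable def reflectProb (v a z : ℝ) : ℝ := (a - z) / v * Real.exp ((2 * z * a - a ^ 2) / (2 * v))

theorem measurable_reflectProb :
    Measurable fun q : ℝ × ℝ × ℝ => reflectProb q.1 q.2.1 q.2.2 := by
  unfold reflectProb; fun_prop

/-- The exponential factor of `reflectProb` is the likelihood ratio of `N(a, v)` to `N(0, v)`. -/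
theorem gaussianPDFReal_mul_reflectProb {v : NNReal} (hv : v ≠ 0) (a z : ℝ) :
    gaussianPDFReal 0 v z * reflectProb v a z = -gaussianMeanDeriv v a z := by
  have hv' : (v : ℝ) ≠ 0 := by exact_mod_cast hv
  have h : Real.exp (-(z - a) ^ 2 / (2 * v)) =
      Real.exp (-(z - 0) ^ 2 / (2 * v)) * Real.exp ((2 * z * a - a ^ 2) / (2 * v)) := by
    rw [← Real.exp_add]; congr 1; field_simp; ring
  rw [gaussianMeanDeriv, gaussianPDFReal, gaussianPDFReal, reflectProb, h]
  ring

/-- For `z ≥ a` the value is nonpositive. For `z ≤ a` the linear factor is at most `1/2 + 1/(2v) ≤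
5/8`, and the exponent is at most `a²/(2v)`, hence small. -/
theorem reflectProb_le_one {v a z : ℝ} (hv : 4 ≤ v) (ha : 0 ≤ a) (ha' : a ≤ 1 / 2)
    (hz : -(v / 2) ≤ z) : reflectProb v a z ≤ 1 := by
  unfold reflectProb
  rcases le_total a z with h | h
  · have : (a - z) / v ≤ 0 := div_nonpos_of_nonpos_of_nonneg (by linarith) (by linarith)
    nlinarith [mul_nonpos_of_nonpos_of_nonneg this
      (Real.exp_pos ((2 * z * a - a ^ 2) / (2 * v))).le]
  · have h1 : (a - z) / v ≤ 5 / 8 := by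
      rw [div_le_iff₀ (by linarith)]; linarith
    have h0 : 0 ≤ (a - z) / v := div_nonneg (by linarith) (by linarith)
    have h2 : (2 * z * a - a ^ 2) / (2 * v) ≤ 1 / 8 := by
      rw [div_le_iff₀ (by linarith)]; nlinarith
    have h3 : Real.exp ((2 * z * a - a ^ 2) / (2 * v)) ≤ 8 / 7 := by
      refine (Real.exp_le_exp.2 h2).trans ?_
      refine (Real.exp_bound_div_one_sub_of_interval (by norm_num) (by norm_num)).trans ?_
      norm_num
    calc _ ≤ 5 / 8 * (8 / 7 : ℝ) := mul_le_mul h1 h3 (Real.exp_pos _).le (by norm_num)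
      _ ≤ 1 := by norm_num

theorem gaussianPDFReal_mul_unitClip {v : NNReal} (hv : 4 ≤ (v : ℝ)) {a z : ℝ} (ha : 0 ≤ a)
    (ha' : a ≤ 1 / 2) (hz : -((v : ℝ) / 2) ≤ z) :
    gaussianPDFReal 0 v z * unitClip (reflectProb v a z) = max 0 (-gaussianMeanDeriv v a z) := by
  have hv0 : v ≠ 0 := by rintro rfl; norm_num at hv
  rw [unitClip, min_eq_right (reflectProb_le_one hv ha ha' hz),
    mul_max_of_nonneg _ _ (gaussianPDFReal_nonneg _ _ _), mul_zero,
    gaussianPDFReal_mul_reflectProb hv0]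

/-- The output density at `z` is `φ_0(z) - q(z) + q(2a - z)`, where `q` is the density of points
that get reflected. On the window `q` is the negative part of the derivative, and by oddness `q(2a -
z)` is its positive part. -/
theorem integral_reflect_gaussian {v : NNReal} (hv : 4 ≤ (v : ℝ)) {a : ℝ} (ha : 0 ≤ a)
    (ha' : a ≤ 1 / 2) {A : Set ℝ} (hA : MeasurableSet A)
    (hAT : A ⊆ Set.Icc (-((v : ℝ) / 2)) (v / 2)) :
    ∫ z, (A.indicator 1 z + unitClip (reflectProb v a z) *
        (A.indicator 1 (2 * a - z) - A.indicator 1 z)) ∂(gaussianReal 0 v) =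
      (∫ z in A, gaussianPDFReal 0 v z) + ∫ z in A, gaussianMeanDeriv v a z := by
  have hv0 : v ≠ 0 := by rintro rfl; norm_num at hv
  set q : ℝ → ℝ := fun z => gaussianPDFReal 0 v z * unitClip (reflectProb v a z) with hq
  have hmeas : Measurable fun z => unitClip (reflectProb v a z) :=
    measurable_unitClip.comp
      (measurable_reflectProb.comp (measurable_const.prodMk (measurable_const.prodMk measurable_id)))
  have hqi : Integrable q := by
    refine (integrable_gaussianPDFReal 0 v).mul_bdd (c := 1) hmeas.aestronglyMeasurable ?_
    refine Filter.Eventually.of_forall fun z => ?_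
    rw [Real.norm_of_nonneg (unitClip_nonneg _)]
    exact unitClip_le_one _
  have hri : Integrable fun w => q (2 * a - w) := hqi.comp_sub_left (2 * a)
  have hphi := integrable_gaussianPDFReal 0 v
  rw [integral_gaussianReal_eq_integral_smul hv0]
  have hsplit : (fun z => gaussianPDFReal 0 v z • (A.indicator (1 : ℝ → ℝ) z +
      unitClip (reflectProb v a z) * (A.indicator 1 (2 * a - z) - A.indicator 1 z))) =
      fun z => (A.indicator (gaussianPDFReal 0 v) z - A.indicator q z) +
        A.indicator (fun w => q (2 * a - w)) (2 * a - z) := by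
    funext z
    by_cases h1 : z ∈ A <;> by_cases h2 : 2 * a - z ∈ A <;>
      simp [Set.indicator, h1, h2, hq, ← sub_eq_add_neg, mul_one_sub]
  have hadd := integral_add ((hphi.indicator hA).sub (hqi.indicator hA))
    ((hri.indicator hA).comp_sub_left (2 * a))
  simp only [Pi.sub_apply] at hadd
  rw [hsplit, hadd, integral_sub (hphi.indicator hA) (hqi.indicator hA),
    integral_sub_left_eq_self (A.indicator fun w => q (2 * a - w)) volume (2 * a),
    integral_indicator hA, integral_indicator hA, integral_indicator hA, sub_add,
    ← integral_sub hqi.integrableOn hri.integrableOn, sub_eq_add_neg, ← integral_neg]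
  congr 1
  refine setIntegral_congr_fun hA fun z hz => ?_
  -- The lower end of the window controls `z`; the upper end, with `a ≥ 0`, controls its mirror
  -- image `2a - z`.
  have hz' := hAT hz
  simp only [hq]
  rw [gaussianPDFReal_mul_unitClip hv ha ha' hz'.1,
    gaussianPDFReal_mul_unitClip hv ha ha' (by linarith [hz'.2]), gaussianMeanDeriv_reflect, neg_neg]
  rcases le_total 0 (gaussianMeanDeriv v a z) with h | h
  · rw [max_eq_left (by linarith), max_eq_right h]; ring
  · rw [max_eq_right (by linarith), max_eq_left h]; ring

/-- Fubini and the fundamental theorem of calculus in the mean; boundedness of `A` makes the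
continuous integrand integrable on a compact box. -/
theorem integral_gaussianMeanDeriv {v : NNReal} (hv : v ≠ 0) {τ T : ℝ} (hτ : 0 ≤ τ) {A : Set ℝ}
    (hAT : A ⊆ Set.Icc (-T) T) :
    ∫ a in (0 : ℝ)..τ, ∫ z in A, gaussianMeanDeriv v a z =
      (∫ z in A, gaussianPDFReal τ v z) - ∫ z in A, gaussianPDFReal 0 v z := by
  have hint : Integrable (fun q : ℝ × ℝ => gaussianMeanDeriv v q.1 q.2)
      ((volume.restrict (Set.Ioc 0 τ)).prod (volume.restrict A)) := by
    rw [Measure.prod_restrict, ← Measure.volume_eq_prod]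
    refine IntegrableOn.mono_set ((continuous_gaussianMeanDeriv v).continuousOn.integrableOn_compact
      ((isCompact_Icc (a := (0 : ℝ)) (b := τ)).prod (isCompact_Icc (a := -T) (b := T)))) ?_
    exact Set.prod_mono Set.Ioc_subset_Icc_self hAT
  rw [intervalIntegral.integral_of_le hτ, integral_integral_swap hint,
    ← integral_sub (integrable_gaussianPDFReal _ _).integrableOn
      (integrable_gaussianPDFReal _ _).integrableOn]
  congr 1
  funext z
  rw [← intervalIntegral.integral_of_le hτ]
  refine intervalIntegral.integral_eq_sub_of_hasDerivAt
    (fun a _ => hasDerivAt_gaussianPDFReal_mean hv a z) ?_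
  exact ((continuous_gaussianMeanDeriv v).comp (Continuous.prodMk_left z)).intervalIntegrable _ _

/-! ### Averaging over the uniform noise. -/

/-- An even function of `y` that is constant on `|y| ≤ 1/2`, integrated over a unit interval. -/
theorem integral_unif_shift {F : ℝ → ℝ} (hF : Continuous F) (c τ : ℝ) (hτ : |τ| ≤ 1 / 2) :
    ∫ ξ, (c + if |τ + ξ| - 1 / 2 ≤ 0 then 0 else F (|τ + ξ| - 1 / 2))
        ∂(unifLaw (-1 / 2) (1 / 2)) = c + ∫ a in (0 : ℝ)..|τ|, F a := by
  set f : ℝ → ℝ := fun y => c + if |y| - 1 / 2 ≤ 0 then 0 else F (|y| - 1 / 2) with hf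
  -- For `τ ≥ 0`, the part of `[τ - 1/2, τ + 1/2]` up to `1/2` has no excess, and on the rest `y -
  -- 1/2` sweeps `(0, τ]`.
  have key : ∀ τ : ℝ, 0 ≤ τ → τ ≤ 1 / 2 →
      ∫ y in (τ - 1 / 2)..(τ + 1 / 2), f y = c + ∫ a in (0 : ℝ)..τ, F a := by
    intro τ h0 h1
    have e1 : Set.EqOn f (fun _ => c) (Set.uIcc (τ - 1 / 2) (1 / 2)) := by
      intro y hy
      rw [Set.uIcc_of_le (by linarith)] at hy
      have : |y| ≤ 1 / 2 := abs_le.2 ⟨by linarith [hy.1], hy.2⟩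
      simp only [hf]
      rw [if_pos (by linarith), add_zero]
    have e2 : Set.EqOn f (fun y => c + F (y - 1 / 2)) (Set.uIoc (1 / 2) (τ + 1 / 2)) := by
      intro y hy
      rw [Set.uIoc_of_le (by linarith)] at hy
      have : |y| = y := abs_of_pos (by linarith [hy.1])
      simp only [hf, this]
      rw [if_neg (by linarith [hy.1])]
    have i1 : IntervalIntegrable f volume (τ - 1 / 2) (1 / 2) :=
      (intervalIntegrable_const (c := c)).congr (e1.symm.mono Set.uIoc_subset_uIcc)
    have hc : Continuous fun y => c + F (y - 1 / 2) := by fun_prop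
    have i2 : IntervalIntegrable f volume (1 / 2) (τ + 1 / 2) :=
      (hc.intervalIntegrable _ _).congr e2.symm
    rw [← intervalIntegral.integral_add_adjacent_intervals i1 i2,
      intervalIntegral.integral_congr e1,
      intervalIntegral.integral_congr_ae (Filter.Eventually.of_forall e2),
      intervalIntegral.integral_add intervalIntegrable_const
        (Continuous.intervalIntegrable (by fun_prop) _ _),
      intervalIntegral.integral_comp_sub_right F (1 / 2)]
    simp only [intervalIntegral.integral_const, smul_eq_mul]
    rw [show (1 / 2 : ℝ) - 1 / 2 = 0 by norm_num, show τ + 1 / 2 - 1 / 2 = τ by ring]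
    ring
  have hshift : ∫ ξ, f (τ + ξ) ∂(unifLaw (-1 / 2) (1 / 2)) =
      ∫ y in (τ - 1 / 2)..(τ + 1 / 2), f y := by
    rw [unifLaw_eq_restrict (by norm_num), integral_Icc_eq_integral_Ioc,
      ← intervalIntegral.integral_of_le (by norm_num),
      intervalIntegral.integral_comp_add_left f τ]
    congr 1; ring
  refine hshift.trans ?_
  rcases le_total 0 τ with h | h
  · rw [abs_of_nonneg h] at hτ ⊢
    exact key τ h hτ
  · rw [abs_of_nonpos h] at hτ ⊢
    rw [← key (-τ) (by linarith) hτ]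
    -- Evenness reduces negative `τ` to `-τ`; this is where the unknown sign disappears.
    have heven : (fun y => f (-y)) = f := by funext y; simp only [hf, abs_neg]
    conv_lhs => rw [← heven]
    rw [intervalIntegral.integral_comp_neg f]
    congr 1 <;> ring

/-! ### The law of the output at one response. -/

/-- The randomized map applied to one response `y`, with a uniform sample `u` and a standard
Gaussian sample `g`. -/
noncomputable def reflectSite (σ y u g : ℝ) : ℝ :=
  if |y| - 1 / 2 ≤ 0 then σ * g
  else if reflectProb (σ ^ 2) (|y| - 1 / 2) (σ * g) ≤ u then σ * g
  else 2 * (|y| - 1 / 2) - σ * g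

theorem measurable_reflectSite (σ : ℝ) :
    Measurable fun q : ℝ × ℝ × ℝ => reflectSite σ q.1 q.2.1 q.2.2 := by
  unfold reflectSite reflectProb
  refine Measurable.ite (measurableSet_le (by fun_prop) (by fun_prop)) (by fun_prop) ?_
  exact Measurable.ite (measurableSet_le (by fun_prop) (by fun_prop)) (by fun_prop) (by fun_prop)

theorem gaussianReal_map_const_mul_one (σ : ℝ) :
    (gaussianReal 0 1).map (σ * ·) = gaussianReal 0 (.mk (σ ^ 2) (sq_nonneg _)) := by
  rw [gaussianReal_map_const_mul, mul_zero, mul_one]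

theorem integral_reflectSite {σ y : ℝ} (hσ : 4 ≤ σ ^ 2) (hy : |y| ≤ 1) {A : Set ℝ}
    (hA : MeasurableSet A) (hAT : A ⊆ Set.Icc (-(σ ^ 2 / 2)) (σ ^ 2 / 2)) :
    ∫ q, A.indicator 1 (reflectSite σ y q.1 q.2) ∂((unifLaw 0 1).prod (gaussianReal 0 1)) =
      (∫ z in A, gaussianPDFReal 0 (.mk (σ ^ 2) (sq_nonneg _)) z) +
      if |y| - 1 / 2 ≤ 0 then 0
      else ∫ z in A, gaussianMeanDeriv (.mk (σ ^ 2) (sq_nonneg _)) (|y| - 1 / 2) z := by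
  set v : NNReal := .mk (σ ^ 2) (sq_nonneg _) with hvdef
  have hvr : (v : ℝ) = σ ^ 2 := rfl
  have hv : 4 ≤ (v : ℝ) := hσ
  have hv0 : v ≠ 0 := by intro h; rw [h] at hv; norm_num at hv
  have hind : Measurable (A.indicator (1 : ℝ → ℝ)) := measurable_one.indicator hA
  have hm : Measurable fun q : ℝ × ℝ => A.indicator (1 : ℝ → ℝ) (reflectSite σ y q.1 q.2) :=
    hind.comp ((measurable_reflectSite σ).comp (measurable_const.prodMk measurable_id))
  have hi : Integrable (fun q : ℝ × ℝ => A.indicator (1 : ℝ → ℝ) (reflectSite σ y q.1 q.2))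
      ((unifLaw 0 1).prod (gaussianReal 0 1)) := by
    refine Integrable.of_bound hm.aestronglyMeasurable 1 (Filter.Eventually.of_forall fun q => ?_)
    refine (norm_indicator_le_norm_self _ _).trans ?_
    simp
  rw [integral_prod_symm _ hi]
  by_cases h : |y| - 1 / 2 ≤ 0
  · have e : ∀ u g, reflectSite σ y u g = σ * g := fun u g => by rw [reflectSite, if_pos h]
    simp only [e, integral_const, probReal_univ, one_smul, if_pos h, add_zero]
    rw [← integral_map (φ := fun g => σ * g) (by fun_prop) hind.aestronglyMeasurable,
      gaussianReal_map_const_mul_one, integral_gaussianReal_eq_integral_smul hv0,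
      ← integral_indicator hA]
    congr 1; funext z
    by_cases hz : z ∈ A <;> simp [hz, hvdef]
  · have e : ∀ g, ∫ u, A.indicator (1 : ℝ → ℝ) (reflectSite σ y u g) ∂(unifLaw 0 1) =
        (fun z => A.indicator 1 z + unitClip (reflectProb v (|y| - 1 / 2) z) *
        (A.indicator 1 (2 * (|y| - 1 / 2) - z) - A.indicator 1 z)) (σ * g) := by
      intro g
      refine Eq.trans ?_ (integral_unif_threshold _ _ _)
      congr 1; funext u
      rw [reflectSite, if_neg h, hvr]
      split_ifs <;> rfl
    simp only [e, if_neg h]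
    rw [← integral_reflect_gaussian hv (by linarith) (by linarith) hA hAT]
    refine (integral_map (φ := fun g => σ * g)
      (f := fun z => A.indicator (1 : ℝ → ℝ) z + unitClip (reflectProb v (|y| - 1 / 2) z) *
        (A.indicator 1 (2 * (|y| - 1 / 2) - z) - A.indicator 1 z))
      (by fun_prop) ?_).symm.trans (by rw [gaussianReal_map_const_mul_one])
    have hc : Measurable fun z => unitClip (reflectProb v (|y| - 1 / 2) z) :=
      measurable_unitClip.comp (measurable_reflectProb.comp
        (measurable_const.prodMk (measurable_const.prodMk measurable_id)))
    have h2 : Measurable fun z => A.indicator (1 : ℝ → ℝ) (2 * (|y| - 1 / 2) - z) :=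
      hind.comp (by fun_prop)
    exact (hind.add (hc.mul (h2.sub hind))).aestronglyMeasurable

/-- On `[-σ²/2, σ²/2]`, the law of the output of `reflectSite` is exactly Gaussian. -/
theorem map_reflectSite_apply {σ τ : ℝ} (hσ : 4 ≤ σ ^ 2) (hτ : |τ| ≤ 1 / 2) {A : Set ℝ}
    (hA : MeasurableSet A) (hAT : A ⊆ Set.Icc (-(σ ^ 2 / 2)) (σ ^ 2 / 2)) :
    ((unifLaw (-1 / 2) (1 / 2)).prod ((unifLaw 0 1).prod (gaussianReal 0 1))).map
      (fun q => reflectSite σ (τ + q.1) q.2.1 q.2.2) A =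
      gaussianReal |τ| (.mk (σ ^ 2) (sq_nonneg _)) A := by
  set v : NNReal := .mk (σ ^ 2) (sq_nonneg _) with hvdef
  have hv : 4 ≤ (v : ℝ) := hσ
  have hv0 : v ≠ 0 := by intro h; rw [h] at hv; norm_num at hv
  have hm : Measurable fun q : ℝ × ℝ × ℝ => reflectSite σ (τ + q.1) q.2.1 q.2.2 :=
    (measurable_reflectSite σ).comp
      (show Measurable fun q : ℝ × ℝ × ℝ => (τ + q.1, q.2.1, q.2.2) by fun_prop)
  have hind : Measurable (A.indicator (1 : ℝ → ℝ)) := measurable_one.indicator hA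
  have hi : Integrable
      (fun q : ℝ × ℝ × ℝ => A.indicator (1 : ℝ → ℝ) (reflectSite σ (τ + q.1) q.2.1 q.2.2))
      ((unifLaw (-1 / 2) (1 / 2)).prod ((unifLaw 0 1).prod (gaussianReal 0 1))) := by
    refine Integrable.of_bound (hind.comp hm).aestronglyMeasurable 1
      (Filter.Eventually.of_forall fun q => ?_)
    refine (norm_indicator_le_norm_self _ _).trans ?_
    simp
  have : IsProbabilityMeasure (((unifLaw (-1 / 2) (1 / 2)).prod
      ((unifLaw 0 1).prod (gaussianReal 0 1))).map
      (fun q => reflectSite σ (τ + q.1) q.2.1 q.2.2)) :=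
    Measure.isProbabilityMeasure_map hm.aemeasurable
  rw [← ENNReal.toReal_eq_toReal_iff' (measure_ne_top _ _) (measure_ne_top _ _),
    ← measureReal_def, ← integral_indicator_one hA,
    integral_map hm.aemeasurable hind.aestronglyMeasurable, integral_prod _ hi,
    gaussianReal_apply_eq_integral _ hv0,
    ENNReal.toReal_ofReal (integral_nonneg fun z => gaussianPDFReal_nonneg _ _ _)]
  have hF : Continuous fun a => ∫ z in A, gaussianMeanDeriv v a z := by
    have := continuous_parametric_integral_of_continuous (μ := volume.restrict A)
      (f := gaussianMeanDeriv v) (continuous_gaussianMeanDeriv v) (isCompact_Icc (a := -(σ ^ 2 / 2)) (b := σ ^ 2 / 2))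
    rwa [Measure.restrict_restrict measurableSet_Icc, Set.inter_eq_right.2 hAT] at this
  -- The target mass becomes `φ_0` plus an increment in the mean; the increment is unfolded into an
  -- average over `ξ`, to be matched pointwise.
  rw [← add_sub_cancel (∫ z in A, gaussianPDFReal 0 v z) (∫ z in A, gaussianPDFReal |τ| v z),
    ← integral_gaussianMeanDeriv hv0 (abs_nonneg τ) hAT, ← integral_unif_shift hF _ _ hτ]
  refine integral_congr_ae ?_
  rw [unifLaw_eq_restrict (by norm_num)]
  filter_upwards [ae_restrict_mem measurableSet_Icc] with ξ hξ
  refine integral_reflectSite hσ ?_ hA hAT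
  have := abs_le.1 hτ
  rw [abs_le]
  constructor <;> linarith [hξ.1, hξ.2]


/-! ### Product laws, Gaussian tails and total variation. -/

theorem measurePreserving_infinitePi_initial {X : Type*} [MeasurableSpace X] (ν : Measure X)
    [IsProbabilityMeasure ν] (n : ℕ) :
    MeasurePreserving (fun (u : ℕ → X) (i : Fin n) => u i) (Measure.infinitePi fun _ : ℕ => ν)
      (Measure.pi fun _ : Fin n => ν) := by
  refine ⟨by fun_prop, (Measure.pi_eq fun s hs => ?_).symm⟩
  rw [Measure.map_apply (by fun_prop) (.univ_pi hs)]
  -- Padding with `Set.univ` turns a box in `n` coordinates into a cylinder on the infinite tape.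
  let t : ℕ → Set X := fun k => if h : k < n then s ⟨k, h⟩ else Set.univ
  have ht : ∀ i : Fin n, t i = s i := fun i => by simp [t]
  have hset : (fun (u : ℕ → X) (i : Fin n) => u i) ⁻¹' (Set.univ.pi s) =
      (Finset.range n : Set ℕ).pi t := by
    ext u
    simp only [Set.mem_preimage, Set.mem_pi, Set.mem_univ, true_imp_iff, Finset.coe_range,
      Set.mem_Iio]
    exact ⟨fun h k hk => by simpa [t, hk] using h ⟨k, hk⟩,
      fun h i => by simpa [ht] using h i i.2⟩
  have htm : ∀ k ∈ Finset.range n, MeasurableSet (t k) := fun k hk => by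
    simpa [t, Finset.mem_range.1 hk] using hs _
  rw [hset, Measure.infinitePi_pi _ htm, Finset.prod_range]
  simp only [ht]

instance isProbabilityMeasure_tapeLaw : IsProbabilityMeasure RealRAM.tapeLaw := by
  unfold RealRAM.tapeLaw; infer_instance

/-- The first `n` noise variables, uniform and Gaussian samples, grouped by index. -/
theorem measurePreserving_pi_prod_tapeLaw (ν : Measure ℝ) [IsProbabilityMeasure ν] (n : ℕ) :
    MeasurePreserving
      (fun (q : (Fin n → ℝ) × RealRAM.Tape) (i : Fin n) => (q.1 i, q.2.1 i, q.2.2 i))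
      ((Measure.pi fun _ : Fin n => ν).prod RealRAM.tapeLaw)
      (Measure.pi fun _ : Fin n => ν.prod ((unifLaw 0 1).prod (gaussianReal 0 1))) := by
  have h1 : MeasurePreserving _ RealRAM.tapeLaw _ :=
    (measurePreserving_infinitePi_initial (unifLaw 0 1) n).prod
      (measurePreserving_infinitePi_initial (gaussianReal 0 1) n)
  have h2 := (measurePreserving_arrowProdEquivProdArrow ℝ ℝ (Fin n) (fun _ => unifLaw 0 1)
    (fun _ => gaussianReal 0 1)).symm.comp h1
  have h3 := (MeasurePreserving.id (Measure.pi fun _ : Fin n => ν)).prod h2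
  exact (measurePreserving_arrowProdEquivProdArrow ℝ (ℝ × ℝ) (Fin n) (fun _ => ν)
    (fun _ => (unifLaw 0 1).prod (gaussianReal 0 1))).symm.comp h3

/-- Product laws whose factors agree on `S i`, each having mass at least `1 - ε` there. -/
theorem abs_pi_real_sub_le {n : ℕ} {Ω : Type*} [MeasurableSpace Ω] (μ ν : Fin n → Measure Ω)
    [∀ i, IsProbabilityMeasure (μ i)] [∀ i, IsProbabilityMeasure (ν i)] {S : Fin n → Set Ω}
    (hS : ∀ i, MeasurableSet (S i)) (h : ∀ i, (μ i).restrict (S i) = (ν i).restrict (S i)) {ε : ℝ}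
    (hε : ∀ i, (ν i).real (S i)ᶜ ≤ ε) {B : Set (Fin n → Ω)} (hB : MeasurableSet B) :
    |(Measure.pi μ).real B - (Measure.pi ν).real B| ≤ n * ε := by
  set S' : Set (Fin n → Ω) := Set.univ.pi S with hS'
  have hSm : MeasurableSet S' := .univ_pi hS
  have hr : (Measure.pi μ).restrict S' = (Measure.pi ν).restrict S' := by
    rw [hS', Measure.restrict_pi_pi, Measure.restrict_pi_pi]
    simp only [h]
  have heq : ∀ A, MeasurableSet A →
      (Measure.pi μ).real (A ∩ S') = (Measure.pi ν).real (A ∩ S') := fun A hA => by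
    rw [measureReal_def, measureReal_def, ← Measure.restrict_apply hA, hr,
      Measure.restrict_apply hA]
  have hν : (Measure.pi ν).real S'ᶜ ≤ n * ε := by
    have hU : S'ᶜ = ⋃ i, Function.eval i ⁻¹' (S i)ᶜ := by
      ext w; simp [hS', Set.mem_pi]
    rw [hU]
    refine (measureReal_iUnion_fintype_le _).trans ?_
    calc _ ≤ ∑ _i : Fin n, ε := Finset.sum_le_sum fun i _ => by
          rw [measureReal_def, (measurePreserving_eval ν i).measure_preimage
            (hS i).compl.nullMeasurableSet]
          exact hε i
      _ = n * ε := by simp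
  -- Both laws give `S'` the same mass, so the tail bound for `ν` passes to `μ`.
  have hμ : (Measure.pi μ).real S'ᶜ ≤ n * ε := by
    rw [probReal_compl_eq_one_sub hSm] at hν ⊢
    have := heq Set.univ .univ
    rw [Set.univ_inter] at this
    rwa [this]
  have d1 := measureReal_inter_add_sdiff (μ := Measure.pi μ) (s := B) hSm
  have d2 := measureReal_inter_add_sdiff (μ := Measure.pi ν) (s := B) hSm
  have b1 : (Measure.pi μ).real (B \ S') ≤ n * ε :=
    (measureReal_mono fun _ hx => hx.2).trans hμ
  have b2 : (Measure.pi ν).real (B \ S') ≤ n * ε :=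
    (measureReal_mono fun _ hx => hx.2).trans hν
  have n1 : 0 ≤ (Measure.pi μ).real (B \ S') := measureReal_nonneg
  have n2 : 0 ≤ (Measure.pi ν).real (B \ S') := measureReal_nonneg
  have := heq B hB
  rw [abs_le]
  constructor <;> linarith

/-- Chernoff bound on each side, with the parameter `(T - |m|)/v` that is optimal for the nearer
endpoint. -/
theorem gaussianReal_real_Icc_compl_le {m T : ℝ} {v : NNReal} (hv : v ≠ 0) (hm : |m| ≤ T) :
    (gaussianReal m v).real (Set.Icc (-T) T)ᶜ ≤ 2 * Real.exp (-(T - |m|) ^ 2 / (2 * v)) := by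
  have hv' : 0 < (v : ℝ) := by positivity
  have hint : ∀ t, Integrable (fun ω : ℝ => Real.exp (t * id ω)) (gaussianReal m v) :=
    fun t => integrable_exp_mul_gaussianReal t
  have hmgf : ∀ t, mgf id (gaussianReal m v) t = Real.exp (m * t + v * t ^ 2 / 2) :=
    fun t => mgf_gaussianReal Measure.map_id t
  have hm' := abs_le.1 (le_refl |m|)
  have hs : 0 ≤ (T - |m|) / v := div_nonneg (by linarith) hv'.le
  have up := measure_ge_le_exp_mul_mgf T hs (hint _)
  have lo := measure_le_le_exp_mul_mgf (-T) (neg_nonpos.2 hs) (hint _)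
  rw [hmgf, ← Real.exp_add] at up lo
  have hsub : (Set.Icc (-T) T)ᶜ ⊆ {ω : ℝ | T ≤ id ω} ∪ {ω : ℝ | id ω ≤ -T} := by
    intro ω hω
    by_contra hc
    simp only [Set.mem_union, Set.mem_ofPred_eq, id, not_or, not_le] at hc
    exact hω ⟨hc.2.le, hc.1.le⟩
  refine (measureReal_mono hsub).trans ((measureReal_union_le _ _).trans ?_)
  have e1 : -((T - |m|) / v) * T + (|m| * ((T - |m|) / v) + v * ((T - |m|) / v) ^ 2 / 2) =
      -(T - |m|) ^ 2 / (2 * v) := by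
    field_simp; ring
  have u1 : Real.exp (-((T - |m|) / v) * T + (m * ((T - |m|) / v) + v * ((T - |m|) / v) ^ 2 / 2)) ≤
      Real.exp (-(T - |m|) ^ 2 / (2 * v)) := by
    rw [← e1]; gcongr; exact hm'.2
  have u2 : Real.exp (- -((T - |m|) / v) * -T +
      (m * -((T - |m|) / v) + v * (-((T - |m|) / v)) ^ 2 / 2)) ≤
      Real.exp (-(T - |m|) ^ 2 / (2 * v)) := by
    rw [← e1]
    refine Real.exp_le_exp.2 ?_
    nlinarith [mul_le_mul_of_nonneg_right hm'.1 hs]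
  linarith

/-- Preimages of events are events; used to discard the fixed covariates. -/
theorem tvDist_map_le {Ω Ω' : Type*} [MeasurableSpace Ω] [MeasurableSpace Ω'] {μ ν : Measure Ω}
    {f : Ω → Ω'} (hf : Measurable f) {ε : ℝ}
    (h : ∀ B, MeasurableSet B → |μ.real B - ν.real B| ≤ ε) :
    tvDist (μ.map f) (ν.map f) ≤ ε := by
  have : Nonempty {A : Set Ω' // MeasurableSet A} := ⟨⟨∅, .empty⟩⟩
  refine ciSup_le fun A => ?_
  rw [map_measureReal_apply hf A.2, map_measureReal_apply hf A.2]
  exact h _ (hf A.2)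

/-! ### The map on data sets and its error. -/

/-- `reflectSite` applied to every response of a data set. -/
noncomputable def reflectMap {n d : ℕ} (σ : ℝ) (D : RegData n d) (ω : RealRAM.Tape) : RegData n d :=
  fun i => ((D i).1, reflectSite σ (D i).2 (ω.1 i) (ω.2 i))

theorem measurable_reflectMap {n d : ℕ} (σ : ℝ) :
    Measurable fun z : RegData n d × RealRAM.Tape => reflectMap σ z.1 z.2 := by
  unfold reflectMap
  refine measurable_pi_lambda _ fun i => Measurable.prodMk (by fun_prop) ?_
  exact (measurable_reflectSite σ).comp
    (show Measurable fun z : RegData n d × RealRAM.Tape => ((z.1 i).2, z.2.1 i, z.2.2 i) by fun_prop)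

/-- Site `i` uses only its own noise, uniform sample and Gaussian sample, so the outputs are
independent. -/
theorem outputLaw_reflectMap {n d : ℕ} (σ : ℝ) (x : Fin n → EuclideanSpace ℝ (Fin d))
    (R : Fin n → ℝ) (β : EuclideanSpace ℝ (Fin d)) :
    RealRAM.outputLaw (reflectMap σ) (mixtureLaw x R β) =
      (Measure.pi fun i =>
        ((unifLaw (-1 / 2) (1 / 2)).prod ((unifLaw 0 1).prod (gaussianReal 0 1))).map
          fun q => reflectSite σ (R i * inner ℝ (x i) β + q.1) q.2.1 q.2.2).map
        fun w i => (x i, w i) := by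
  have hs : ∀ i, Measurable fun q : ℝ × ℝ × ℝ =>
      reflectSite σ (R i * inner ℝ (x i) β + q.1) q.2.1 q.2.2 := fun i =>
    (measurable_reflectSite σ).comp
      (show Measurable fun q : ℝ × ℝ × ℝ => (R i * inner ℝ (x i) β + q.1, q.2.1, q.2.2) by fun_prop)
  have : ∀ i, IsProbabilityMeasure
      (((unifLaw (-1 / 2) (1 / 2)).prod ((unifLaw 0 1).prod (gaussianReal 0 1))).map
          fun q => reflectSite σ (R i * inner ℝ (x i) β + q.1) q.2.1 q.2.2) := fun i =>
    Measure.isProbabilityMeasure_map (hs i).aemeasurable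
  have hp : Measurable fun (t : Fin n → ℝ × ℝ × ℝ) (i : Fin n) =>
      reflectSite σ (R i * inner ℝ (x i) β + (t i).1) (t i).2.1 (t i).2.2 :=
    measurable_pi_lambda _ fun i => (hs i).comp (measurable_pi_apply i)
  have hx : Measurable fun (w : Fin n → ℝ) (i : Fin n) => (x i, w i) := by fun_prop
  have hmix : Measurable fun (ξ : Fin n → ℝ) (i : Fin n) =>
      (x i, R i * inner ℝ (x i) β + ξ i) := by fun_prop
  rw [← Measure.pi_map_pi fun i => (hs i).aemeasurable,
    ← (measurePreserving_pi_prod_tapeLaw (unifLaw (-1 / 2) (1 / 2)) n).map_eq,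
    Measure.map_map hx hp, Measure.map_map (hx.comp hp) (by fun_prop),
    RealRAM.outputLaw, mixtureLaw]
  nth_rewrite 1 [← Measure.map_id (μ := RealRAM.tapeLaw)]
  rw [Measure.map_prod_map _ _ hmix measurable_id,
    Measure.map_map (measurable_reflectMap σ) (hmix.prodMap measurable_id)]
  rfl

theorem phaseLaw_eq {n d : ℕ} (σ : ℝ) (x : Fin n → EuclideanSpace ℝ (Fin d))
    (β : EuclideanSpace ℝ (Fin d)) :
    phaseLaw x β σ =
      (Measure.pi fun i => gaussianReal |inner ℝ (x i) β| (.mk (σ ^ 2) (sq_nonneg _))).map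
        fun w i => (x i, w i) := by
  have h : ∀ m : ℝ, (gaussianReal 0 1).map (fun ε => m + σ * ε) =
      gaussianReal m (.mk (σ ^ 2) (sq_nonneg _)) := fun m => by
    have := gaussianReal_map_const_add (μ := 0) (v := .mk (σ ^ 2) (sq_nonneg _)) m
    rwa [← gaussianReal_map_const_mul_one, Measure.map_map (by fun_prop) (by fun_prop),
      zero_add] at this
  simp only [← h]
  have : ∀ i, IsProbabilityMeasure
      ((gaussianReal 0 1).map (fun ε => |inner ℝ (x i) β| + σ * ε)) := fun i =>
    Measure.isProbabilityMeasure_map (by fun_prop)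
  rw [← Measure.pi_map_pi (fun i => by fun_prop), Measure.map_map (by fun_prop) (by fun_prop)]
  rfl

/-- Guarantees `σ² ≥ 16`, enough for the reflection bound and for the window to contain the means.
-/
theorem one_le_log_twenty_mul_div {n : ℕ} (hn : 0 < n) {δ : ℝ} (h0 : 0 < δ) (h1 : δ < 1) :
    1 ≤ Real.log (20 * n / δ) := by
  have hn' : (1 : ℝ) ≤ n := by exact_mod_cast hn
  rw [Real.le_log_iff_exp_le (by positivity), le_div_iff₀ h0]
  nlinarith [Real.exp_one_lt_d9, Real.exp_pos 1]

theorem tvDist_outputLaw_reflectMap_le {n d : ℕ} (hn : 0 < n) {δ : ℝ} (h0 : 0 < δ) (h1 : δ < 1)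
    (x : Fin n → EuclideanSpace ℝ (Fin d)) (R : Fin n → ℝ) (β : EuclideanSpace ℝ (Fin d))
    (hR : ∀ i, R i = -1 ∨ R i = 1) (hx : ∀ i, |inner ℝ (x i) β| ≤ 1 / 2) :
    tvDist (RealRAM.outputLaw (reflectMap (4 * √(Real.log (20 * n / δ)))) (mixtureLaw x R β))
      (phaseLaw x β (4 * √(Real.log (20 * n / δ)))) ≤ δ := by
  set L := Real.log (20 * n / δ) with hL
  set σ := 4 * √L with hσdef
  have hn' : (1 : ℝ) ≤ n := by exact_mod_cast hn
  have hL1 : 1 ≤ L := one_le_log_twenty_mul_div hn h0 h1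
  have hσ : σ ^ 2 = 16 * L := by rw [hσdef, mul_pow, Real.sq_sqrt (by linarith)]; norm_num
  rw [outputLaw_reflectMap, phaseLaw_eq]
  have hs : ∀ i, Measurable fun q : ℝ × ℝ × ℝ =>
      reflectSite σ (R i * inner ℝ (x i) β + q.1) q.2.1 q.2.2 := fun i =>
    (measurable_reflectSite σ).comp
      (show Measurable fun q : ℝ × ℝ × ℝ => (R i * inner ℝ (x i) β + q.1, q.2.1, q.2.2) by fun_prop)
  have : ∀ i, IsProbabilityMeasure
      (((unifLaw (-1 / 2) (1 / 2)).prod ((unifLaw 0 1).prod (gaussianReal 0 1))).map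
          fun q => reflectSite σ (R i * inner ℝ (x i) β + q.1) q.2.1 q.2.2) := fun i =>
    Measure.isProbabilityMeasure_map (hs i).aemeasurable
  refine tvDist_map_le (by fun_prop) fun B hB => ?_
  have hbound := abs_pi_real_sub_le
    (fun i => ((unifLaw (-1 / 2) (1 / 2)).prod ((unifLaw 0 1).prod (gaussianReal 0 1))).map
      fun q => reflectSite σ (R i * inner ℝ (x i) β + q.1) q.2.1 q.2.2)
    (fun i => gaussianReal |inner ℝ (x i) β| (.mk (σ ^ 2) (sq_nonneg _)))
    (S := fun _ => Set.Icc (-(σ ^ 2 / 2)) (σ ^ 2 / 2)) (fun _ => measurableSet_Icc)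
    (ε := 2 * Real.exp (-L)) ?_ ?_ hB
  · refine hbound.trans ?_
    rw [hL, Real.exp_neg, Real.exp_log (by positivity), inv_div]
    have : (n : ℝ) * (2 * (δ / (20 * n))) = δ / 10 := by field_simp; norm_num
    rw [this]; linarith
  · intro i
    have habs : |R i * inner ℝ (x i) β| = |inner ℝ (x i) β| := by
      rcases hR i with h | h <;> simp [h]
    ext A hA
    rw [Measure.restrict_apply hA, Measure.restrict_apply hA, ← habs]
    exact map_reflectSite_apply (by linarith) (habs ▸ hx i) (hA.inter measurableSet_Icc)
      Set.inter_subset_right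
  · intro i
    have hi := hx i
    refine (gaussianReal_real_Icc_compl_le ?_ ?_).trans ?_
    · intro h
      have : σ ^ 2 = 0 := congrArg NNReal.toReal h
      linarith
    · rw [abs_abs]; linarith
    · gcongr
      change -(σ ^ 2 / 2 - |(|inner ℝ (x i) β|)|) ^ 2 / (2 * σ ^ 2) ≤ -L
      rw [abs_abs, hσ, div_le_iff₀ (by linarith)]
      -- With `m = |⟨x_i, β⟩| ≤ 1/2` and `L ≥ 1`, one has `8L - m ≥ 7.5 L`, and `(7.5 L)² ≥ 32 L²`.
      nlinarith [abs_nonneg (inner ℝ (x i) β)]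


/-! ### The program and its running time. -/

namespace RealRAM

/-- The noise level `4 √(log (20 n / δ))`. -/
def sigmaExpr : RealExpr :=
  .mul (.const 4) (.sqrt (.log (.div (.mul (.const 20) (.ofNat (.reg 0))) (.cell 2 (.const 0)))))

/-- The reflection probability, for the point in array `4` and the centre in array `5`. -/
def probExpr : RealExpr :=
  .mul (.div (.sub (.cell 5 (.const 0)) (.cell 4 (.const 0))) (.mul sigmaExpr sigmaExpr))
    (.exp (.div
      (.sub (.mul (.mul (.const 2) (.cell 4 (.const 0))) (.cell 5 (.const 0)))
        (.mul (.cell 5 (.const 0)) (.cell 5 (.const 0))))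
      (.mul (.const 2) (.mul sigmaExpr sigmaExpr))))

/-- Draw the samples for the response with index in register `2`, and store the default output. -/
def siteSetup : Prog :=
  .seq (.unif 3 (.const 0)) <| .seq (.gauss 4 (.const 0)) <|
  .seq (.setReal 4 (.const 0) (.mul sigmaExpr (.cell 4 (.const 0)))) <|
  .seq (.setReal 5 (.const 0)
    (.sub (.sqrt (.mul (.cell 1 (.reg 2)) (.cell 1 (.reg 2)))) (.const (1 / 2)))) <|
  .setReal 1 (.reg 2) (.cell 4 (.const 0))

/-- Reflect the stored output if the test on the uniform sample says so. -/
def siteReflect : Prog :=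
  .ite (.realLe (.cell 5 (.const 0)) (.const 0)) .skip <|
  .ite (.realLe probExpr (.cell 3 (.const 0))) .skip <|
  .setReal 1 (.reg 2) (.sub (.mul (.const 2) (.cell 5 (.const 0))) (.cell 4 (.const 0)))

/-- One pass of the loop. -/
def siteBody : Prog :=
  .seq siteSetup (.seq siteReflect (.setNat 2 (.add (.reg 2) (.const 1))))

/-- The whole program. -/
def reflectProg : Prog := .while (.not (.natLe (.reg 0) (.reg 2))) siteBody

/-- The absolute value is computed as `√(y * y)`, and it is saved in array `5` before the response
is overwritten. -/
theorem exec_siteSetup (ω : Tape) (s : State) : ∃ (s' : State) (t : ℕ),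
    Exec ω siteSetup s s' t ∧ t ≤ 34 ∧ s'.nat = s.nat ∧ s'.uPos = s.uPos + 1 ∧ s'.gPos = s.gPos + 1 ∧
      s'.real 0 = s.real 0 ∧ s'.real 2 = s.real 2 ∧ s'.real 3 0 = ω.1 s.uPos ∧
      s'.real 4 0 = 4 * √(Real.log (20 * s.nat 0 / s.real 2 0)) * ω.2 s.gPos ∧
      s'.real 5 0 = |s.real 1 (s.nat 2)| - 1 / 2 ∧
      s'.real 1 = Function.update (s.real 1) (s.nat 2) (s'.real 4 0) := by
  refine ⟨_, _, .seq (.unif _ _ _) (.seq (.gauss _ _ _) (.seq (.setReal _ _ _ _)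
    (.seq (.setReal _ _ _ _) (.setReal _ _ _ _)))), ?_⟩
  simp [State.setReal, RealExpr.eval, NatExpr.eval, RealExpr.cost, NatExpr.cost, sigmaExpr,
    Real.sqrt_mul_self_eq_abs]

theorem exec_siteReflect (ω : Tape) (s : State) : ∃ (s' : State) (t : ℕ),
    Exec ω siteReflect s s' t ∧ t ≤ 100 ∧ s'.nat = s.nat ∧ s'.uPos = s.uPos ∧ s'.gPos = s.gPos ∧
      s'.real 0 = s.real 0 ∧ s'.real 2 = s.real 2 ∧
      s'.real 1 = if s.real 5 0 ≤ 0 then s.real 1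
        else if reflectProb ((4 * √(Real.log (20 * s.nat 0 / s.real 2 0))) ^ 2)
          (s.real 5 0) (s.real 4 0) ≤ s.real 3 0 then s.real 1
        else Function.update (s.real 1) (s.nat 2) (2 * s.real 5 0 - s.real 4 0) := by
  have e0 : (BoolExpr.realLe (.cell 5 (.const 0)) (.const 0)).holds s ↔ s.real 5 0 ≤ 0 := by
    simp [BoolExpr.holds, RealExpr.eval, NatExpr.eval]
  have e1 : (BoolExpr.realLe probExpr (.cell 3 (.const 0))).holds s ↔
      reflectProb ((4 * √(Real.log (20 * s.nat 0 / s.real 2 0))) ^ 2)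
        (s.real 5 0) (s.real 4 0) ≤ s.real 3 0 := by
    simp only [BoolExpr.holds, probExpr, sigmaExpr, RealExpr.eval, NatExpr.eval, reflectProb,
      pow_two, Rat.cast_ofNat]
  by_cases h0 : s.real 5 0 ≤ 0
  · refine ⟨s, _, .iteTrue (e0.2 h0) (.skip s), ?_⟩
    simp [h0, BoolExpr.cost, RealExpr.cost, NatExpr.cost]
  · by_cases h1 : reflectProb ((4 * √(Real.log (20 * s.nat 0 / s.real 2 0))) ^ 2)
        (s.real 5 0) (s.real 4 0) ≤ s.real 3 0
    · refine ⟨s, _, .iteFalse (e0.not.2 h0) (.iteTrue (e1.2 h1) (.skip s)), ?_⟩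
      simp [h0, h1, BoolExpr.cost, RealExpr.cost, NatExpr.cost, probExpr, sigmaExpr]
    · refine ⟨_, _, .iteFalse (e0.not.2 h0) (.iteFalse (e1.not.2 h1) (.setReal _ _ _ _)), ?_⟩
      simp [h0, h1, BoolExpr.cost, RealExpr.cost, NatExpr.cost, probExpr, sigmaExpr,
        State.setReal, RealExpr.eval, NatExpr.eval]

theorem exec_siteBody (ω : Tape) (s : State) : ∃ (s' : State) (t : ℕ),
    Exec ω siteBody s s' t ∧ t ≤ 138 ∧ s'.nat = Function.update s.nat 2 (s.nat 2 + 1) ∧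
      s'.uPos = s.uPos + 1 ∧ s'.gPos = s.gPos + 1 ∧
      s'.real 0 = s.real 0 ∧ s'.real 2 = s.real 2 ∧
      s'.real 1 = Function.update (s.real 1) (s.nat 2)
        (reflectSite (4 * √(Real.log (20 * s.nat 0 / s.real 2 0))) (s.real 1 (s.nat 2))
          (ω.1 s.uPos) (ω.2 s.gPos)) := by
  obtain ⟨a, t₀, ha, ht₀, an, au, ag, a0, a2, a3, a4, a5, a1⟩ := exec_siteSetup ω s
  obtain ⟨b, t, hb, ht, bn, bu, bg, b0, b2, b1⟩ := exec_siteReflect ω a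
  refine ⟨_, _, .seq ha (.seq hb (.setNat _ _ _)), ?_, ?_⟩
  · simp only [NatExpr.cost]; omega
  · simp only [State.setNat, NatExpr.eval, bn, an, bu, au, bg, ag, b0, a0, b2, a2, b1, a3, a4, a5,
      a1, reflectSite, true_and]
    split_ifs <;> simp

/-- Induction on the number `k` of remaining responses. Each pass consumes one uniform and one
Gaussian sample whether or not it needs them, so both tape positions stay equal to the loop index. A
pass costs at most `138`, plus `4` for the test. -/
theorem exec_reflectProg (ω : Tape) (n : ℕ) (δ : ℝ) (k : ℕ) : ∀ s : State, s.nat 0 = n →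
    s.nat 2 + k = n → s.uPos = s.nat 2 → s.gPos = s.nat 2 → s.real 2 0 = δ →
    ∃ (s' : State) (t : ℕ), Exec ω reflectProg s s' t ∧ t ≤ 142 * k + 4 ∧
      s'.real 0 = s.real 0 ∧ ∀ j, s'.real 1 j = if s.nat 2 ≤ j ∧ j < n then
        reflectSite (4 * √(Real.log (20 * n / δ))) (s.real 1 j) (ω.1 j) (ω.2 j)
        else s.real 1 j := by
  induction k with
  | zero =>
    intro s h0 hk hu hg hδ
    refine ⟨s, _, .whileFalse ?_, ?_, rfl, fun j => ?_⟩
    · simp only [BoolExpr.holds, NatExpr.eval]; omega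
    · simp [BoolExpr.cost, NatExpr.cost]
    · rw [if_neg (by omega)]
  | succ k ih =>
    intro s h0 hk hu hg hδ
    obtain ⟨a, t, ha, ht, an, au, ag, a0, a2, a1⟩ := exec_siteBody ω s
    have an2 : a.nat 2 = s.nat 2 + 1 := by simp [an]
    obtain ⟨b, t', hb, ht', b0, b1⟩ := ih a (by simp [an, h0]) (by omega) (by omega) (by omega)
      (by rw [a2, hδ])
    refine ⟨b, _, .whileTrue ?_ ha hb, ?_, b0.trans a0, fun j => ?_⟩
    · simp only [BoolExpr.holds, NatExpr.eval]; omega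
    · simp only [BoolExpr.cost, NatExpr.cost]; omega
    · rw [b1 j, an2, a1, h0, hδ, hu, hg]
      -- The remaining passes start at the next index, so the cell written in this pass keeps its
      -- value.
      rcases eq_or_ne j (s.nat 2) with rfl | hj
      · rw [if_neg (by omega), if_pos (by omega), Function.update_self]
      · rw [Function.update_of_ne hj]
        exact if_congr (by omega) rfl rfl

theorem reflectProg_computes {n d : ℕ} (δ : ℝ) :
    reflectProg.Computes (n := n) (d := d) δ (reflectMap (4 * √(Real.log (20 * n / δ))))
      (142 * n + 4) := by
  intro D ω
  obtain ⟨s, t, hs, ht, h0, h1⟩ := exec_reflectProg ω n δ n (inputState δ D) (by simp [inputState])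
    (by simp [inputState]) (by simp [inputState]) (by simp [inputState]) (by simp [inputState])
  refine ⟨s, t, hs, ?_, by exact_mod_cast ht⟩
  funext i
  refine Prod.ext ?_ ?_
  · ext j
    have hlt : (finProdFinEquiv (i, j)).1 < n * d := (finProdFinEquiv (i, j)).2
    simp only [State.output, h0, inputState, if_true, dif_pos hlt, Fin.eta,
      Equiv.symm_apply_apply, reflectMap]
  · simp [State.output, h1, inputState, reflectMap]

end RealRAM

theorem corollary1 :
    ∃ C : ℝ, 0 < C ∧ ∃ (P : RealRAM.Prog) (p : MvPolynomial (Fin 2) ℝ),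
      ∀ (n d : ℕ), 0 < n → ∀ δ : ℝ, 0 < δ → δ < 1 →
        ∃ h : RegData n d → RealRAM.Tape → RegData n d,
          Measurable (fun z : RegData n d × RealRAM.Tape => h z.1 z.2) ∧
          P.Computes δ h (MvPolynomial.eval ![(n : ℝ), Real.log (1 / δ)] p) ∧
          ∀ (x : Fin n → EuclideanSpace ℝ (Fin d)) (R : Fin n → ℝ)
            (β : EuclideanSpace ℝ (Fin d)),
            (∀ i, R i = -1 ∨ R i = 1) → (∀ i, |inner ℝ (x i) β| ≤ 1 / 2) →
            tvDist (RealRAM.outputLaw h (mixtureLaw x R β))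
              (phaseLaw x β (C * Real.sqrt (Real.log (20 * n / δ)))) ≤ δ := by
  refine ⟨4, by norm_num, RealRAM.reflectProg,
    MvPolynomial.C 142 * MvPolynomial.X 0 + MvPolynomial.C 4, fun n d hn δ h0 h1 =>
    ⟨reflectMap (4 * √(Real.log (20 * n / δ))), measurable_reflectMap _, ?_,
      fun x R β hR hx => tvDist_outputLaw_reflectMap_le hn h0 h1 x R β hR hx⟩⟩
  simpa using RealRAM.reflectProg_computes δ
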